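/- Let $\mathbb{T}\subseteq\mathbb{R}$ be a time scale (a nonempty closed set) with $0,T\in\mathbb{T}$, $0<T$, and put $I:=[0,T]\cap\mathbb{T}$. For a time scale $S$, let $\sigma_S(t)=\inf\{s\in S:s>t\}$ and $\rho_S(t)=\sup\{s\in S:s<t\}$, where $\sigma_S(\max S)=\max S$ and $\rho_S(\min S)=\min S$ if these exist; let $S^{\kappa}$ be $S$ without its maximum if $S$ has a maximum $m$ and $\rho_S(m)<m$, and $S^\kappa=S$ otherwise; and let $S^{\kappa^2}=(S^\kappa)^\kappa$. A number $d$ is a $\Delta$-derivative $f^\Delta(t)$ of $f:S\to\mathbb{R}$ at $t\in S^\kappa$ if for every $\varepsilon>0$ one has $|f(\sigma_S(t))-f(s)-d(\sigma_S(t)-s)|\le\varepsilon|\sigma_S(t)-s|$ for all $s\in S$ in a neighbourhood of $t$. Write $\sigma=\sigma_{\mathbb{T}}$, $\mu(t)=\sigma(t)-t$ and $\mu^\sigma=\mu\circ\sigma$ on $\mathbb{T}$; the derivative $\mu^\Delta$ is taken on $\mathbb{T}$. A function $f:I^\kappa\to\mathbb{R}$ is rd-continuous if it is continuous at every $t\in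 I^\kappa$ with $\sigma_I(t)=t$ and has a finite left-sided limit at every $t\in I^\kappa$ with $\rho_I(t)=t$. Given $\pi_0,\pi_T\in\mathbb{R}$, a function $\pi:I\to\mathbb{R}$ is admissible if it is $\Delta$-differentiable on $I^\kappa$, $\pi^\Delta$ is rd-continuous, $\pi(0)=\pi_0$ and $\pi(T)=\pi_T$. For $G:I^\kappa\times\mathbb{R}^2\to\mathbb{R}$ write $G[\pi](t)=G(t,\pi(t),\pi^\Delta(t))$. Let $L:I^\kappa\times\mathbb{R}^2\to\mathbb{R}$, $(t,y,v)\mapsto L(t,y,v)$, be such that $L(t,\cdot,\cdot)$ is differentiable for every $t\in I^\kappa$ and such that, for every admissible $\pi$ and each $G\in\{L,L_y,L_v\}$, the function $G(t,\cdot,\cdot)$ is continuous at $(\pi(t),\pi^\Delta(t))$ uniformly in $t\in I^\kappa$, and $G[\pi]$ is rd-continuous. Let $$\mathcal{L}(\pi)=\int_0^T L(t,\pi(t),\pi^\Delta(t))\,\Delta t:=F(T)-F(0),\qquad F:I\to\mathbb{R},\quad F^\Delta=L[\pi]\ \text{ on } I^\kappa .$$ Let $\hat\pi$ be a local minimizer: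 $\hat\pi$ is admissible, and there is $\delta>0$ with $\mathcal{L}(\hat\pi)\le\mathcal{L}(\pi)$ for all admissible $\pi$ with $\sup_{I^\kappa}|\pi-\hat\pi|+\sup_{I^\kappa}|\pi^\Delta-\hat\pi^\Delta|<\delta$. **Theorem 4.1.** If $\mu$ is $\Delta$-differentiable at every point of $I^\kappa=[0,T]^\kappa_{\mathbb{T}}$, then for every $t\in[0,T]^{\kappa^2}_{\mathbb{T}}=I^{\kappa^2}$ the function $L_v[\hat\pi]:I^\kappa\to\mathbb{R}$ is $\Delta$-differentiable at $t$ and $$\big(L_v[\hat\pi]\big)^\Delta(t)=\big(1+\mu^\Delta(t)\big)L_y[\hat\pi](t)+\mu^\sigma(t)\,\big(L_y[\hat\pi]\big)^\Delta(t).$$ Here the derivatives of $L_v[\hat\pi]$ and $L_y[\hat\pi]$ are taken on their domain $I^\kappa$. The function $L_y[\hat\pi]$ is $\Delta$-differentiable at $t$ whenever $\sigma(t)>t$; if $\sigma(t)=t$, then $\mu^\sigma(t)=0$ and the last term is read as $0$, whether or not $L_y[\hat\pi]$ is $\Delta$-differentiable at $t$. (If $I^\kappa$ is a single point, that is $I=\{0,T\}$,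 then every number is a $\Delta$-derivative there and the equation is void: the right-hand side is one such number.) -/

import Mathlib

open Filter Topology

noncomputable section

namespace TimeScale

/-- A time scale is a nonempty closed subset of the real line. -/
def IsTimeScale (S : Set ℝ) : Prop := S.Nonempty ∧ IsClosed S

open Classical in
/-- Forward jump operator: `σ t = inf {s ∈ S : s > t}`, and `σ t = t` at the maximum of `S`. -/
def sigma (S : Set ℝ) (t : ℝ) : ℝ :=
  if {s ∈ S | t < s}.Nonempty then sInf {s ∈ S | t < s} else t

open Classical in
/-- Backward jump operator: `ρ t = sup {s ∈ S : s < t}`, and `ρ t = t` at the minimum of `S`. -/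
def rho (S : Set ℝ) (t : ℝ) : ℝ :=
  if {s ∈ S | s < t}.Nonempty then sSup {s ∈ S | s < t} else t

/-- Forward graininess. -/
def graininess (S : Set ℝ) (t : ℝ) : ℝ := sigma S t - t

/-- `S^κ`: the set `S` without its maximum if that maximum exists and is left-scattered. -/
def kappa (S : Set ℝ) : Set ℝ := {t ∈ S | ¬ (IsGreatest S t ∧ rho S t < t)}

/-- `d` is a Δ-derivative at `t` of the restriction of `f` to the time scale `S`
(only the values of `f` on `S` enter). -/
def HasDeltaDerivAt (S : Set ℝ) (f : ℝ → ℝ) (d t : ℝ) : Prop :=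
  ∀ ε > 0, ∀ᶠ s in 𝓝[S] t,
    |f (sigma S t) - f s - d * (sigma S t - s)| ≤ ε * |sigma S t - s|

def DeltaDifferentiableAt (S : Set ℝ) (f : ℝ → ℝ) (t : ℝ) : Prop :=
  ∃ d, HasDeltaDerivAt S f d t

open Classical in
/-- The Δ-derivative `f^Δ(t)` relative to `S` (the value `0` if there is none). -/
def deltaDeriv (S : Set ℝ) (f : ℝ → ℝ) (t : ℝ) : ℝ :=
  if h : ∃ d, HasDeltaDerivAt S f d t then h.choose else 0

/-- Rd-continuity of `f : D → ℝ`, where `D` is `S` or `S^κ`: continuity at the right-dense points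
and existence of finite left-sided limits at the left-dense points. -/
def RdContinuousOn (S D : Set ℝ) (f : ℝ → ℝ) : Prop :=
  (∀ t ∈ D, sigma S t = t → ContinuousWithinAt f D t) ∧
  (∀ t ∈ D, rho S t = t → ∃ l : ℝ, Tendsto f (𝓝[D ∩ Set.Iio t] t) (𝓝 l))

/-- The class `C¹_rd(S, ℝ)`. -/
def IsC1rd (S : Set ℝ) (f : ℝ → ℝ) : Prop :=
  (∀ t ∈ kappa S, DeltaDifferentiableAt S f t) ∧ RdContinuousOn S (kappa S) (deltaDeriv S f)

def IsAntiderivative (S : Set ℝ) (F f : ℝ → ℝ) : Prop :=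
  ∀ t ∈ kappa S, HasDeltaDerivAt S F (f t) t

open Classical in
/-- The Δ-integral `∫_a^b f(t) Δt = F(b) - F(a)`, with `F` an antiderivative of `f` on `S`
(antiderivatives are unique up to a constant, and rd-continuous functions have one;
the value is `0` if `f` has none). -/
def deltaIntegral (S : Set ℝ) (f : ℝ → ℝ) (a b : ℝ) : ℝ :=
  if h : ∃ F, IsAntiderivative S F f then h.choose b - h.choose a else 0

/-- `L_y`, the partial derivative of `(t, y, v) ↦ L t y v` in `y`. -/
def partialY (L : ℝ → ℝ → ℝ → ℝ) (t y v : ℝ) : ℝ := deriv (fun u => L t u v) y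

/-- `L_v`, the partial derivative of `(t, y, v) ↦ L t y v` in `v`. -/
def partialV (L : ℝ → ℝ → ℝ → ℝ) (t y v : ℝ) : ℝ := deriv (fun w => L t y w) v

/-- `G[y](t) = G(t, y(t), y^Δ(t))`. -/
def along (S : Set ℝ) (G : ℝ → ℝ → ℝ → ℝ) (y : ℝ → ℝ) (t : ℝ) : ℝ :=
  G t (y t) (deltaDeriv S y t)

/-- Admissible paths on the time scale `S` (with end points `a`, `b`). -/
def Admissible (S : Set ℝ) (a b ya yb : ℝ) (y : ℝ → ℝ) : Prop :=
  IsC1rd S y ∧ y a = ya ∧ y b = yb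

/-- `‖y‖ = sup_{S^κ} |y| + sup_{S^κ} |y^Δ|`. -/
def c1Norm (S : Set ℝ) (y : ℝ → ℝ) : ℝ :=
  sSup ((fun t => |y t|) '' kappa S) + sSup ((fun t => |deltaDeriv S y t|) '' kappa S)

/-- `G(t, ·, ·)` is continuous at `(y(t), y^Δ(t))`, uniformly in `t ∈ S^κ`. -/
def UniformlyContinuousAlong (S : Set ℝ) (G : ℝ → ℝ → ℝ → ℝ) (y : ℝ → ℝ) : Prop :=
  ∀ ε > 0, ∃ δ > 0, ∀ t ∈ kappa S, ∀ u v : ℝ,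
    |u - y t| < δ → |v - deltaDeriv S y t| < δ → |G t u v - along S G y t| < ε

/-- Standing assumptions on a Lagrangian `L : S^κ × ℝ² → ℝ`: `L(t, ·, ·)` is differentiable, and
along every admissible path `y` each of `L`, `L_y`, `L_v` is continuous at `(y, y^Δ)`, uniformly
in `t`, and rd-continuous in `t`. -/
structure IsLagrangian (S : Set ℝ) (a b ya yb : ℝ) (L : ℝ → ℝ → ℝ → ℝ) : Prop where
  differentiable : ∀ t ∈ kappa S, Differentiable ℝ (fun p : ℝ × ℝ => L t p.1 p.2)
  uniform : ∀ y, Admissible S a b ya yb y →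
    UniformlyContinuousAlong S L y ∧ UniformlyContinuousAlong S (partialY L) y ∧
      UniformlyContinuousAlong S (partialV L) y
  rdContinuous : ∀ y, Admissible S a b ya yb y →
    RdContinuousOn S (kappa S) (along S L y) ∧
      RdContinuousOn S (kappa S) (along S (partialY L) y) ∧
      RdContinuousOn S (kappa S) (along S (partialV L) y)

/-- The functional `y ↦ ∫_a^b L(t, y(t), y^Δ(t)) Δt`. -/
def functional (S : Set ℝ) (a b : ℝ) (L : ℝ → ℝ → ℝ → ℝ) (y : ℝ → ℝ) : ℝ :=
  deltaIntegral S (along S L y) a b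

/-- Local minimizers of the functional among the admissible paths. -/
def IsLocalMinimizer (S : Set ℝ) (a b ya yb : ℝ) (L : ℝ → ℝ → ℝ → ℝ) (y₀ : ℝ → ℝ) : Prop :=
  Admissible S a b ya yb y₀ ∧
  ∃ δ > 0, ∀ y, Admissible S a b ya yb y → c1Norm S (fun t => y t - y₀ t) < δ →
    functional S a b L y₀ ≤ functional S a b L y

/-- The interval `[a, b]_S = [a, b] ∩ S`. -/
def interval (S : Set ℝ) (a b : ℝ) : Set ℝ := Set.Icc a b ∩ S

end TimeScale

end

namespace TimeScale

/-! Write `f` and `g` for `L_y` and `L_v` along the minimizer and `A` for a Δ-primitive of `f`. The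
proof differentiates the integral Euler–Lagrange equation `g = c + A ∘ σ` on `S^κ`
(`exists_along_partialV_eq`). That equation is du Bois-Reymond's argument: the first variation
vanishes (`firstVariation_eq_zero`), and testing it with the primitive of `k = g - A ∘ σ - c`, where
`c` is chosen so that this primitive vanishes at both ends, gives `∫ k² = 0` after integration by
parts, hence `k = 0`.

At a right-scattered `t`, differentiability of `μ` forces `t` to be isolated. If `σ(t)` lies in
`S^κ`, all Δ-derivatives on `S^κ` at `t` are then difference quotients, and the formula is algebra:
`A(σ(σ(t))) - A(σ(t)) = μ^σ f(σ(t))`, `f(σ(t)) = f + μ f^Δ`, `μ^σ = (1 + μ^Δ) μ`. If not, every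
number is a derivative.

At a right-dense `t`, one has `σ(s) - t = (1 + μ^Δ(t)) (s - t) + o(s - t)`, so a chain rule gives `A
∘ σ` the derivative `(1 + μ^Δ(t)) f(t)` (`hasDeltaDerivAt_primitive_comp_sigma`). Differentiability
of `f` plays no role there.

The underlying integral calculus comes from realizing the Δ-integral as the Lebesgue integral of a
step extension (`isAntiderivative_primitive`); uniqueness of primitives is
`eq_of_hasDeltaDerivAt_zero`. -/

/-- A closed set with least element `a` and greatest element `b`, where `a < b`. -/
structure IsCompactScale (S : Set ℝ) (a b : ℝ) : Prop where
  isClosed : IsClosed S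
  subset : S ⊆ Set.Icc a b
  left_mem : a ∈ S
  right_mem : b ∈ S
  lt : a < b

/-! ### Jump operators. -/

theorem sigma_of_forall_le {S : Set ℝ} {t : ℝ} (h : ∀ s ∈ S, s ≤ t) : sigma S t = t :=
  if_neg fun ⟨s, hs, hts⟩ => (h s hs).not_gt hts

theorem le_sigma (S : Set ℝ) (t : ℝ) : t ≤ sigma S t := by
  unfold sigma
  split_ifs with h
  · exact le_csInf h fun s hs => hs.2.le
  · exact le_rfl

theorem sigma_le {S : Set ℝ} {s t : ℝ} (hs : s ∈ S) (hts : t < s) : sigma S t ≤ s := by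
  unfold sigma
  rw [if_pos ⟨s, hs, hts⟩]
  exact csInf_le ⟨t, fun u hu => hu.2.le⟩ ⟨hs, hts⟩

theorem sigma_mem {S : Set ℝ} (hS : IsClosed S) {t : ℝ} (ht : t ∈ S) : sigma S t ∈ S := by
  unfold sigma
  split_ifs with h
  · exact hS.closure_subset_iff.2 (fun u hu => hu.1) (csInf_mem_closure h ⟨t, fun u hu => hu.2.le⟩)
  · exact ht

theorem exists_mem_Ioo_of_sigma_eq {S : Set ℝ} {s t ε : ℝ} (hs : s ∈ S) (hts : t < s)
    (ht : sigma S t = t) (hε : 0 < ε) : ∃ u ∈ S, t < u ∧ u < t + ε := by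
  unfold sigma at ht
  have hne : {s ∈ S | t < s}.Nonempty := ⟨s, hs, hts⟩
  rw [if_pos hne] at ht
  obtain ⟨u, hu, hut⟩ := exists_lt_of_csInf_lt hne (by rw [ht]; linarith : sInf _ < t + ε)
  exact ⟨u, hu.1, hu.2, hut⟩

theorem sigma_eq_of_forall_exists {S : Set ℝ} {t : ℝ}
    (h : ∀ ε > 0, ∃ u ∈ S, t < u ∧ u < t + ε) : sigma S t = t := by
  refine le_antisymm (le_of_forall_pos_le_add fun ε hε => ?_) (le_sigma S t)
  obtain ⟨u, hu, htu, hut⟩ := h ε hε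
  exact (sigma_le hu htu).trans hut.le

theorem rho_le (S : Set ℝ) (t : ℝ) : rho S t ≤ t := by
  unfold rho
  split_ifs with h
  · exact csSup_le h fun s hs => hs.2.le
  · exact le_rfl

theorem le_rho {S : Set ℝ} {s t : ℝ} (hs : s ∈ S) (hst : s < t) : s ≤ rho S t := by
  unfold rho
  rw [if_pos ⟨s, hs, hst⟩]
  exact le_csSup ⟨t, fun u hu => hu.2.le⟩ ⟨hs, hst⟩

theorem rho_mem {S : Set ℝ} (hS : IsClosed S) {t : ℝ} (ht : t ∈ S) : rho S t ∈ S := by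
  unfold rho
  split_ifs with h
  · exact hS.closure_subset_iff.2 (fun u hu => hu.1) (csSup_mem_closure h ⟨t, fun u hu => hu.2.le⟩)
  · exact ht

theorem exists_mem_Ioo_of_rho_eq {S : Set ℝ} {s t ε : ℝ} (hs : s ∈ S) (hst : s < t)
    (ht : rho S t = t) (hε : 0 < ε) : ∃ u ∈ S, t - ε < u ∧ u < t := by
  unfold rho at ht
  have hne : {s ∈ S | s < t}.Nonempty := ⟨s, hs, hst⟩
  rw [if_pos hne] at ht
  obtain ⟨u, hu, hut⟩ := exists_lt_of_lt_csSup hne (by rw [ht]; linarith : t - ε < sSup _)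
  exact ⟨u, hu.1, hut, hu.2⟩

theorem kappa_subset (S : Set ℝ) : kappa S ⊆ S := fun _ h => h.1

/-! ### Calculus of Δ-derivatives. -/

theorem hasDeltaDerivAt_iff_isLittleO {S : Set ℝ} {f : ℝ → ℝ} {d t : ℝ} :
    HasDeltaDerivAt S f d t ↔
      (fun s => f (sigma S t) - f s - d * (sigma S t - s)) =o[𝓝[S] t]
        (fun s => sigma S t - s) := by
  rw [Asymptotics.isLittleO_iff]
  rfl

namespace HasDeltaDerivAt

variable {S : Set ℝ} {f g : ℝ → ℝ} {d e t : ℝ}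

theorem add (hf : HasDeltaDerivAt S f d t) (hg : HasDeltaDerivAt S g e t) :
    HasDeltaDerivAt S (fun s => f s + g s) (d + e) t := by
  rw [hasDeltaDerivAt_iff_isLittleO] at *
  exact (hf.add hg).congr_left fun s => by ring

theorem const_mul (c : ℝ) (hf : HasDeltaDerivAt S f d t) :
    HasDeltaDerivAt S (fun s => c * f s) (c * d) t := by
  rw [hasDeltaDerivAt_iff_isLittleO] at *
  exact (hf.const_mul_left c).congr_left fun s => by ring

theorem sub (hf : HasDeltaDerivAt S f d t) (hg : HasDeltaDerivAt S g e t) :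
    HasDeltaDerivAt S (fun s => f s - g s) (d - e) t := by
  rw [hasDeltaDerivAt_iff_isLittleO] at *
  exact (hf.sub hg).congr_left fun s => by ring

theorem tendsto (hf : HasDeltaDerivAt S f d t) :
    Tendsto f (𝓝[S] t) (𝓝 (f (sigma S t) - d * (sigma S t - t))) := by
  rw [hasDeltaDerivAt_iff_isLittleO] at hf
  have hid : Tendsto (fun s : ℝ => sigma S t - s) (𝓝[S] t) (𝓝 (sigma S t - t)) :=
    (tendsto_const_nhds.sub tendsto_id).mono_left nhdsWithin_le_nhds
  have h0 := (hf.trans_isBigO (hid.isBigO_one ℝ)).tendsto_zero_of_tendsto tendsto_const_nhds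
  have := (tendsto_const_nhds (x := f (sigma S t))).sub (h0.add (hid.const_mul d))
  refine (this.congr fun s => ?_).trans (by simp)
  ring

/-- The neighbourhoods in the definition contain `t` itself, so the limit of `f` along `𝓝[S] t` must
be `f t`. -/
theorem sub_eq (hf : HasDeltaDerivAt S f d t) (ht : t ∈ S) :
    f (sigma S t) - f t = d * (sigma S t - t) := by
  have := tendsto_nhds_unique (hf.tendsto.mono_left (pure_le_nhdsWithin ht))
    (tendsto_pure_nhds f t)
  linarith

theorem continuousWithinAt (hf : HasDeltaDerivAt S f d t) (ht : t ∈ S) :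
    ContinuousWithinAt f S t := by
  have := hf.tendsto
  rwa [← hf.sub_eq ht, sub_sub_cancel] at this

/-- The remainder of the product is `f(σ(t))` times the remainder of `g`, plus the remainder of `f`
times `g(s)`, plus `d (σ(t) - s) (g(s) - g(t))`; continuity of `g` at `t` handles the last two. -/
theorem mul (hf : HasDeltaDerivAt S f d t) (hg : HasDeltaDerivAt S g e t) (ht : t ∈ S) :
    HasDeltaDerivAt S (fun s => f s * g s) (d * g t + f (sigma S t) * e) t := by
  have hgc := hg.continuousWithinAt ht
  rw [hasDeltaDerivAt_iff_isLittleO] at *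
  have h1 := hg.const_mul_left (f (sigma S t))
  have h2 := (hf.mul_isBigO (hgc.tendsto.isBigO_one ℝ)).congr_right fun s => mul_one _
  have h3 : (fun s => d * (sigma S t - s) * (g s - g t)) =o[𝓝[S] t]
      (fun s => sigma S t - s) := by
    have h0 : Tendsto (fun s => g s - g t) (𝓝[S] t) (𝓝 0) := by
      simpa using hgc.tendsto.sub_const (g t)
    exact ((Asymptotics.isBigO_const_mul_self d _ _).mul_isLittleO
      ((Asymptotics.isLittleO_one_iff ℝ).2 h0)).congr_right fun s => mul_one _
  exact ((h1.add h2).add h3).congr_left fun s => by ring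

theorem unique_of_lt (hf : HasDeltaDerivAt S f d t) (hf' : HasDeltaDerivAt S f e t) (ht : t ∈ S)
    (h : t < sigma S t) : d = e :=
  mul_right_cancel₀ (sub_pos.2 h).ne' ((hf.sub_eq ht).symm.trans (hf'.sub_eq ht))

theorem unique_of_frequently (hf : HasDeltaDerivAt S f d t) (hf' : HasDeltaDerivAt S f e t)
    (h : ∃ᶠ s in 𝓝[S] t, sigma S t ≠ s) : d = e := by
  by_contra hne
  have h0 := hf'.sub hf
  have hpos : 0 < |e - d| := abs_pos.2 (sub_ne_zero.2 (Ne.symm hne))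
  obtain ⟨s, hs, hle⟩ := (h.and_eventually (h0 (|e - d| / 2) (by positivity))).exists
  have : 0 < |sigma S t - s| := abs_pos.2 (sub_ne_zero.2 hs)
  rw [show f (sigma S t) - f (sigma S t) - (f s - f s) - (e - d) * (sigma S t - s) = -((e - d) * (sigma S t - s)) by ring,
    abs_neg, abs_mul] at hle
  nlinarith

end HasDeltaDerivAt

/-- As `s → t` the error tends to `0` while the allowed bound tends to `ε μ(t) > 0`, so continuity
alone suffices. -/
theorem hasDeltaDerivAt_of_lt {S : Set ℝ} {f : ℝ → ℝ} {t : ℝ} (hf : ContinuousWithinAt f S t)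
    (h : t < sigma S t) :
    HasDeltaDerivAt S f ((f (sigma S t) - f t) / (sigma S t - t)) t := by
  intro ε hε
  set d := (f (sigma S t) - f t) / (sigma S t - t)
  have hd : d * (sigma S t - t) = f (sigma S t) - f t := div_mul_cancel₀ _ (sub_pos.2 h).ne'
  have hid : Tendsto (fun s : ℝ => sigma S t - s) (𝓝[S] t) (𝓝 (sigma S t - t)) :=
    (tendsto_const_nhds.sub tendsto_id).mono_left nhdsWithin_le_nhds
  have h1 := ((tendsto_const_nhds (x := f (sigma S t))).sub hf.tendsto |>.sub
    (hid.const_mul d)).abs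
  have h2 := hid.abs.const_mul ε
  rw [hd, sub_self, abs_zero] at h1
  refine (h1.eventually_lt h2 ?_).mono fun s hs => hs.le
  have : 0 < |sigma S t - t| := abs_pos.2 (sub_pos.2 h).ne'
  positivity

theorem HasDeltaDerivAt.of_eventually_eq_self {S : Set ℝ} (f : ℝ → ℝ) (d : ℝ) {t : ℝ}
    (hσ : sigma S t = t) (h : ∀ᶠ s in 𝓝[S] t, s = t) : HasDeltaDerivAt S f d t := by
  intro ε hε
  filter_upwards [h] with s hs
  simp [hσ, hs]

theorem DeltaDifferentiableAt.hasDeltaDerivAt {S : Set ℝ} {f : ℝ → ℝ} {t : ℝ}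
    (h : DeltaDifferentiableAt S f t) : HasDeltaDerivAt S f (deltaDeriv S f t) t := by
  have h' : ∃ d, HasDeltaDerivAt S f d t := h
  unfold deltaDeriv
  rw [dif_pos h']
  exact h'.choose_spec

/-! ### Algebra of rd-continuous functions. -/

namespace RdContinuousOn

variable {S D : Set ℝ} {f g : ℝ → ℝ}

theorem congr (hf : RdContinuousOn S D f) (h : ∀ t ∈ D, g t = f t) : RdContinuousOn S D g := by
  refine ⟨fun t ht hσ => (hf.1 t ht hσ).congr h (h t ht), fun t ht hρ => ?_⟩
  obtain ⟨l, hl⟩ := hf.2 t ht hρ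
  refine ⟨l, hl.congr' ?_⟩
  filter_upwards [self_mem_nhdsWithin] with s hs using (h s hs.1).symm

theorem add (hf : RdContinuousOn S D f) (hg : RdContinuousOn S D g) :
    RdContinuousOn S D (fun t => f t + g t) := by
  refine ⟨fun t ht hσ => (hf.1 t ht hσ).add (hg.1 t ht hσ), fun t ht hρ => ?_⟩
  obtain ⟨l, hl⟩ := hf.2 t ht hρ
  obtain ⟨m, hm⟩ := hg.2 t ht hρ
  exact ⟨l + m, hl.add hm⟩

theorem mul (hf : RdContinuousOn S D f) (hg : RdContinuousOn S D g) :
    RdContinuousOn S D (fun t => f t * g t) := by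
  refine ⟨fun t ht hσ => (hf.1 t ht hσ).mul (hg.1 t ht hσ), fun t ht hρ => ?_⟩
  obtain ⟨l, hl⟩ := hf.2 t ht hρ
  obtain ⟨m, hm⟩ := hg.2 t ht hρ
  exact ⟨l * m, hl.mul hm⟩

theorem const (c : ℝ) : RdContinuousOn S D (fun _ => c) :=
  ⟨fun _ _ _ => continuousWithinAt_const, fun _ _ _ => ⟨c, tendsto_const_nhds⟩⟩

theorem sub (hf : RdContinuousOn S D f) (hg : RdContinuousOn S D g) :
    RdContinuousOn S D (fun t => f t - g t) :=
  (hf.add ((const (-1)).mul hg)).congr fun t _ => by ring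

theorem _root_.ContinuousOn.rdContinuousOn (hf : ContinuousOn f D) : RdContinuousOn S D f :=
  ⟨fun t ht _ => hf t ht,
    fun t ht _ => ⟨f t, (hf t ht).tendsto.mono_left (nhdsWithin_mono t Set.inter_subset_left)⟩⟩

end RdContinuousOn

/-! ### Compact time scales: the set `S^κ`, uniqueness of derivatives, vanishing derivatives,
boundedness. -/

namespace IsCompactScale

variable {S : Set ℝ} {a b : ℝ}

theorem isCompact (h : IsCompactScale S a b) : IsCompact S :=
  isCompact_Icc.of_isClosed_subset h.isClosed h.subset

theorem isGreatest (h : IsCompactScale S a b) : IsGreatest S b :=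
  ⟨h.right_mem, fun _ hs => (h.subset hs).2⟩

theorem sigma_right (h : IsCompactScale S a b) : sigma S b = b :=
  sigma_of_forall_le fun _ hs => (h.subset hs).2

theorem mem_kappa_of_lt (h : IsCompactScale S a b) {t : ℝ} (ht : t ∈ S) (htb : t < b) :
    t ∈ kappa S :=
  ⟨ht, fun hg => (hg.1.2 h.right_mem).not_gt htb⟩

theorem left_mem_kappa (h : IsCompactScale S a b) : a ∈ kappa S :=
  h.mem_kappa_of_lt h.left_mem h.lt

theorem right_mem_kappa_iff (h : IsCompactScale S a b) : b ∈ kappa S ↔ rho S b = b :=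
  ⟨fun hb => (rho_le S b).antisymm (not_lt.1 fun hlt => hb.2 ⟨h.isGreatest, hlt⟩),
    fun hb => ⟨h.right_mem, fun hg => hg.2.ne hb⟩⟩

theorem mem_kappa_of_le (h : IsCompactScale S a b) {s t : ℝ} (hs : s ∈ S) (ht : t ∈ kappa S)
    (hst : s ≤ t) : s ∈ kappa S := by
  rcases (h.subset hs).2.lt_or_eq with hlt | rfl
  · exact h.mem_kappa_of_lt hs hlt
  · rwa [hst.antisymm (h.subset ht.1).2]

theorem _root_.TimeScale.mem_kappa_of_rho_eq {t : ℝ} (ht : t ∈ S) (hρ : rho S t = t) :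
    t ∈ kappa S := ⟨ht, fun hg => hg.2.ne hρ⟩

theorem kappa_mem_nhdsWithin (h : IsCompactScale S a b) {t : ℝ} (ht : t ∈ kappa S) :
    kappa S ∈ 𝓝[S] t := by
  rcases (h.subset ht.1).2.lt_or_eq with hlt | rfl
  · filter_upwards [self_mem_nhdsWithin, mem_nhdsWithin_of_mem_nhds (Iio_mem_nhds hlt)]
      with s hs hsb using h.mem_kappa_of_lt hs hsb
  · filter_upwards [self_mem_nhdsWithin] with s hs
      using h.mem_kappa_of_le hs ht (h.subset hs).2

theorem nhdsWithin_kappa (h : IsCompactScale S a b) {t : ℝ} (ht : t ∈ kappa S) :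
    𝓝[kappa S] t = 𝓝[S] t :=
  le_antisymm (nhdsWithin_mono t (kappa_subset S))
    (nhdsWithin_le_iff.2 (h.kappa_mem_nhdsWithin ht))

theorem isClosed_kappa (h : IsCompactScale S a b) : IsClosed (kappa S) := by
  by_cases hb : b ∈ kappa S
  · have : kappa S = S := (kappa_subset S).antisymm fun s hs =>
      h.mem_kappa_of_le hs hb (h.subset hs).2
    rw [this]
    exact h.isClosed
  · have hρ : rho S b < b := (rho_le S b).lt_of_ne fun he => hb (h.right_mem_kappa_iff.2 he)
    have : kappa S = S ∩ Set.Iic (rho S b) := by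
      ext s
      refine ⟨fun hs => ⟨hs.1, le_rho hs.1 ((h.subset hs.1).2.lt_of_ne ?_)⟩,
        fun hs => h.mem_kappa_of_lt hs.1 (hs.2.trans_lt hρ)⟩
      rintro rfl
      exact hb hs
    rw [this]
    exact h.isClosed.inter isClosed_Iic

theorem isCompact_kappa (h : IsCompactScale S a b) : IsCompact (kappa S) :=
  h.isCompact.of_isClosed_subset h.isClosed_kappa (kappa_subset S)

/-- Points of `S` accumulate at `t` from the right if `t < b`, and from the left if `t = b`, since
`b` stays in `S^κ` only when it is left-dense. This is what makes Δ-derivatives unique on `S^κ`. -/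
theorem frequently_ne_of_sigma_eq (h : IsCompactScale S a b) {t : ℝ} (ht : t ∈ kappa S)
    (hσ : sigma S t = t) : ∃ᶠ s in 𝓝[S] t, t ≠ s := by
  rw [Metric.nhdsWithin_basis_ball.frequently_iff]
  intro ε hε
  rcases (h.subset ht.1).2.lt_or_eq with hlt | rfl
  · obtain ⟨u, hu, h1, h2⟩ := exists_mem_Ioo_of_sigma_eq h.right_mem hlt hσ hε
    exact ⟨u, ⟨by rw [Metric.mem_ball, Real.dist_eq, abs_lt]; constructor <;> linarith, hu⟩, h1.ne⟩
  · obtain ⟨u, hu, h1, h2⟩ := exists_mem_Ioo_of_rho_eq h.left_mem h.lt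
      (h.right_mem_kappa_iff.1 ht) hε
    exact ⟨u, ⟨by rw [Metric.mem_ball, Real.dist_eq, abs_lt]; constructor <;> linarith, hu⟩, h2.ne'⟩

theorem hasDeltaDerivAt_unique (h : IsCompactScale S a b) {f : ℝ → ℝ} {d e t : ℝ}
    (ht : t ∈ kappa S) (hd : HasDeltaDerivAt S f d t) (he : HasDeltaDerivAt S f e t) : d = e := by
  rcases (le_sigma S t).lt_or_eq with hlt | heq
  · exact hd.unique_of_lt he ht.1 hlt
  · refine hd.unique_of_frequently he ?_
    rw [← heq]
    exact h.frequently_ne_of_sigma_eq ht heq.symm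

theorem deltaDeriv_eq (h : IsCompactScale S a b) {f : ℝ → ℝ} {d t : ℝ}
    (ht : t ∈ kappa S) (hd : HasDeltaDerivAt S f d t) : deltaDeriv S f t = d :=
  h.hasDeltaDerivAt_unique ht (DeltaDifferentiableAt.hasDeltaDerivAt ⟨d, hd⟩) hd

/-- Induction along the time scale, run at the infimum `m` of the points violating the bound. If `m`
itself violates it, the bound carries over from `ρ(m)` (where `f` has the same value) or, at a
left-dense `m`, by continuity. If not, violations accumulate at `m` from the right, and the zero
derivative at the right-dense `m` excludes them. -/
theorem abs_sub_le_of_hasDeltaDerivAt_zero (h : IsCompactScale S a b) {f : ℝ → ℝ}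
    (hf : ∀ t ∈ kappa S, HasDeltaDerivAt S f 0 t) {ε : ℝ} (hε : 0 < ε) {t : ℝ} (ht : t ∈ S) :
    |f t - f a| ≤ ε * (t - a) := by
  by_contra! hbad
  set N := {s ∈ S | ε * (s - a) < |f s - f a|}
  have hN : N.Nonempty := ⟨t, ht, hbad⟩
  have hbd : BddBelow N := ⟨a, fun s hs => (h.subset hs.1).1⟩
  set m := sInf N
  have hm : m ∈ S := h.isClosed.closure_subset_iff.2 (fun u hu => hu.1) (csInf_mem_closure hN hbd)
  have hgood : ∀ s ∈ S, s < m → |f s - f a| ≤ ε * (s - a) := fun s hs hsm =>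
    not_lt.1 fun hlt => (csInf_le hbd ⟨hs, hlt⟩).not_gt hsm
  by_cases hmN : m ∈ N
  · have ham : a < m := (h.subset hm).1.lt_of_ne fun he => by
      have := hmN.2
      rw [← he] at this
      simp at this
    rcases (rho_le S m).lt_or_eq with hlt | heq
    · have hr := rho_mem h.isClosed hm
      have hrb : rho S m < b := hlt.trans_le (h.subset hm).2
      have hσ : sigma S (rho S m) = m := by
        -- If `σ(ρ(m)) < m`, then `σ(ρ(m)) ≤ ρ(m)`, so `ρ(m)` is right-dense and some point of `S`
        -- lies strictly between `ρ(m)` and `m`.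
        refine (sigma_le hm hlt).antisymm (not_lt.1 fun hlt' => ?_)
        have hle := le_rho (sigma_mem h.isClosed hr) hlt'
        exact absurd (exists_mem_Ioo_of_sigma_eq h.right_mem hrb
          (hle.antisymm (le_sigma S _)) (sub_pos.2 hlt)) (by
            rintro ⟨u, hu, h1, h2⟩
            exact (le_rho hu (by linarith)).not_gt h1)
      have h1 := (hf _ (h.mem_kappa_of_lt hr hrb)).sub_eq hr
      rw [hσ, zero_mul, sub_eq_zero] at h1
      have h2 := hgood _ hr hlt
      have h3 := hmN.2
      rw [h1] at h3
      nlinarith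
    · have hc := (hf m (mem_kappa_of_rho_eq hm heq)).continuousWithinAt hm
      have hne : (𝓝[S ∩ Set.Iio m] m).NeBot := by
        rw [Metric.nhdsWithin_basis_ball.neBot_iff]
        intro ε hε
        obtain ⟨u, hu, h1, h2⟩ := exists_mem_Ioo_of_rho_eq h.left_mem ham heq hε
        exact ⟨u, by rw [Metric.mem_ball, Real.dist_eq, abs_lt]; constructor <;> linarith, hu, h2⟩
      have hc' := hc.mono_left (nhdsWithin_mono m (Set.inter_subset_left (t := Set.Iio m)))
      have hid : Tendsto (fun s : ℝ => ε * (s - a)) (𝓝[S ∩ Set.Iio m] m) (𝓝 (ε * (m - a))) :=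
        ((tendsto_id.sub_const a).const_mul ε).mono_left nhdsWithin_le_nhds
      have := le_of_tendsto_of_tendsto (hc'.sub_const (f a)).abs hid (by
        filter_upwards [self_mem_nhdsWithin] with s hs using hgood s hs.1 hs.2)
      exact this.not_gt hmN.2
  · have hm_good : |f m - f a| ≤ ε * (m - a) := not_lt.1 fun hlt => hmN ⟨hm, hlt⟩
    have hnear : ∀ δ > 0, ∃ u ∈ N, m < u ∧ u < m + δ := fun δ hδ => by
      obtain ⟨u, hu, hlt⟩ := exists_lt_of_csInf_lt hN (by linarith : m < m + δ)
      exact ⟨u, hu, (csInf_le hbd hu).lt_of_ne fun he => hmN (by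
        have he' : m = u := he
        rwa [he']), hlt⟩
    have hσ : sigma S m = m := sigma_eq_of_forall_exists fun δ hδ =>
      let ⟨u, hu, h1⟩ := hnear δ hδ
      ⟨u, hu.1, h1⟩
    have hmb : m < b := by
      obtain ⟨u, hu, h1, -⟩ := hnear 1 one_pos
      exact h1.trans_le (h.subset hu.1).2
    have hd := hf m (h.mem_kappa_of_lt hm hmb) ε hε
    rw [Metric.nhdsWithin_basis_ball.eventually_iff] at hd
    obtain ⟨δ, hδ, hd⟩ := hd
    obtain ⟨u, hu, h1, h2⟩ := hnear δ hδ
    have h3 := hd ⟨by rw [Metric.mem_ball, Real.dist_eq, abs_lt]; constructor <;> linarith, hu.1⟩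
    rw [hσ, zero_mul, sub_zero, abs_sub_comm, abs_sub_comm m, abs_of_pos (sub_pos.2 h1)] at h3
    have h4 := hu.2
    have h5 := abs_sub_le (f u) (f m) (f a)
    linarith

theorem eq_of_hasDeltaDerivAt_zero (h : IsCompactScale S a b) {f : ℝ → ℝ}
    (hf : ∀ t ∈ kappa S, HasDeltaDerivAt S f 0 t) {t : ℝ} (ht : t ∈ S) : f t = f a := by
  by_contra hne
  have hpos : 0 < |f t - f a| := abs_pos.2 (sub_ne_zero.2 hne)
  have hta : 0 ≤ t - a := sub_nonneg.2 (h.subset ht).1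
  -- The `+ 1` covers `t = a` and makes the resulting bound strictly smaller than `|f t - f a|`.
  have h1 := h.abs_sub_le_of_hasDeltaDerivAt_zero hf
    (div_pos hpos (by linarith : 0 < t - a + 1)) ht
  have h2 : |f t - f a| / (t - a + 1) * (t - a) < |f t - f a| := by
    rw [div_mul_eq_mul_div, div_lt_iff₀ (by linarith)]
    nlinarith
  linarith

theorem tendsto_sigma (h : IsCompactScale S a b) {t : ℝ} (ht : t ∈ kappa S)
    (hσ : sigma S t = t) : Tendsto (sigma S) (𝓝[kappa S] t) (𝓝[S] t) := by
  refine tendsto_nhdsWithin_iff.2 ⟨?_, by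
    filter_upwards [self_mem_nhdsWithin] with s hs using sigma_mem h.isClosed hs.1⟩
  refine tendsto_order.2 ⟨fun u hu => ?_, fun u hu => ?_⟩
  · filter_upwards [mem_nhdsWithin_of_mem_nhds (Ioi_mem_nhds hu)] with s hs
      using hs.trans_le (le_sigma S s)
  · rcases (h.subset ht.1).2.lt_or_eq with hlt | rfl
    · obtain ⟨v, hv, h1, h2⟩ := exists_mem_Ioo_of_sigma_eq h.right_mem hlt hσ (sub_pos.2 hu)
      filter_upwards [mem_nhdsWithin_of_mem_nhds (Iio_mem_nhds h1)] with s hs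
      have := sigma_le hv hs
      linarith
    · filter_upwards [self_mem_nhdsWithin] with s hs
      exact ((h.subset (sigma_mem h.isClosed hs.1)).2).trans_lt hu

/-- At a left-dense `t`, `s ≤ σ(s) ≤ t` for `s < t`, so the left limit is `f t`, even where `σ(t) >
t`. -/
theorem rdContinuousOn_comp_sigma (h : IsCompactScale S a b) {f : ℝ → ℝ} (hf : ContinuousOn f S) :
    RdContinuousOn S (kappa S) (fun t => f (sigma S t)) := by
  refine ⟨fun t ht hσ => ?_, fun t ht _ => ⟨f t, ?_⟩⟩
  · show Tendsto _ _ _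
    simp only [hσ]
    exact (hf t ht.1).tendsto.comp (h.tendsto_sigma ht hσ)
  · refine (hf t ht.1).tendsto.comp (tendsto_nhdsWithin_iff.2 ⟨?_, by
      filter_upwards [self_mem_nhdsWithin] with s hs using sigma_mem h.isClosed hs.1.1⟩)
    refine tendsto_of_tendsto_of_tendsto_of_le_of_le' (tendsto_id.mono_left nhdsWithin_le_nhds)
      tendsto_const_nhds ?_ ?_
    · exact Eventually.of_forall fun s => le_sigma S s
    · filter_upwards [self_mem_nhdsWithin] with s hs using sigma_le ht.1 hs.2

/-- By compactness of `S^κ` a local bound is enough. At a right-dense point it comes from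
continuity; at a right-scattered one all nearby points are at or left of `t`, and the left limit
bounds `f` there. -/
theorem exists_bound (h : IsCompactScale S a b) {f : ℝ → ℝ} (hf : RdContinuousOn S (kappa S) f) :
    ∃ C, 0 < C ∧ ∀ t ∈ kappa S, |f t| ≤ C := by
  suffices H : ∃ C, ∀ t ∈ kappa S, |f t| ≤ C by
    obtain ⟨C, hC⟩ := H
    exact ⟨max C 1, by positivity, fun t ht => (hC t ht).trans (le_max_left _ _)⟩
  refine h.isCompact_kappa.induction_on (p := fun A => ∃ C, ∀ t ∈ A, |f t| ≤ C) ⟨0, by simp⟩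
    (fun A B hAB ⟨C, hC⟩ => ⟨C, fun t ht => hC t (hAB ht)⟩)
    (fun A B ⟨C, hC⟩ ⟨D, hD⟩ => ⟨max C D, fun t ht => ht.elim
      (fun ht => (hC t ht).trans (le_max_left _ _)) fun ht => (hD t ht).trans (le_max_right _ _)⟩)
    fun t ht => ?_
  rcases (le_sigma S t).lt_or_eq with hlt | heq
  · obtain ⟨l, hl⟩ : ∃ l, Tendsto f (𝓝[kappa S ∩ Set.Iio t] t) (𝓝 l) := by
      rcases (rho_le S t).lt_or_eq with hlt' | heq'
      -- At a left-scattered point the left filter is trivial, so any value is a limit.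
      · refine ⟨0, ?_⟩
        have : 𝓝[kappa S ∩ Set.Iio t] t = ⊥ := by
          rw [← empty_mem_iff_bot]
          filter_upwards [self_mem_nhdsWithin, mem_nhdsWithin_of_mem_nhds (Ioi_mem_nhds hlt')]
            with s hs hs'
          exact (le_rho hs.1.1 hs.2).not_gt hs'
        rw [this]
        exact tendsto_bot
      · exact hf.2 t ht heq'
    have hev := hl.abs.eventually_lt_const (lt_add_one |l|)
    rw [eventually_nhdsWithin_iff] at hev
    refine ⟨{s | |f s| ≤ max (|l| + 1) |f t|}, ?_, _, fun s hs => hs⟩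
    filter_upwards [mem_nhdsWithin_of_mem_nhds hev, self_mem_nhdsWithin,
      mem_nhdsWithin_of_mem_nhds (Iio_mem_nhds hlt)] with s h1 hs h2
    rcases lt_trichotomy s t with hst | rfl | hst
    · exact (h1 ⟨hs, hst⟩).le.trans (le_max_left _ _)
    · exact le_max_right _ _
    · exact absurd (sigma_le hs.1 hst) (not_le.2 h2)
  · have hev := (hf.1 t ht heq.symm).tendsto.abs.eventually_lt_const (lt_add_one |f t|)
    exact ⟨_, hev, |f t| + 1, fun s hs => le_of_lt hs⟩

end IsCompactScale

/-! ### Primitives of rd-continuous functions through the Lebesgue integral. -/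

/-- The last point of `S` at or before `max a x`. -/
noncomputable def lastPoint (S : Set ℝ) (a x : ℝ) : ℝ := sSup {s ∈ S | s ≤ max a x}

/-- The extension of `f : S^κ → ℝ` to the real line which is constant on the gaps of `S`. -/
noncomputable def stepExtension (S : Set ℝ) (a : ℝ) (f : ℝ → ℝ) (x : ℝ) : ℝ :=
  (kappa S).indicator f (lastPoint S a x)

/-- The Δ-integral of `f` from `a` to `t`, as the Lebesgue integral of the step extension. -/
noncomputable def primitive (S : Set ℝ) (a : ℝ) (f : ℝ → ℝ) (t : ℝ) : ℝ :=
  ∫ x in a..t, stepExtension S a f x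

theorem countable_setOf_lt_sigma (S : Set ℝ) : {t ∈ S | t < sigma S t}.Countable := by
  refine Set.PairwiseDisjoint.countable_of_Ioo (y := sigma S) ?_ fun t ht => ht.2
  intro s hs t ht hst
  wlog hlt : s < t generalizing s t with H
  · exact (H ht hs hst.symm (lt_of_le_of_ne (not_lt.1 hlt) hst.symm)).symm
  refine Set.disjoint_left.2 fun u hu hu' => ?_
  exact ((hu.2.trans_le (sigma_le ht.1 hlt)).trans hu'.1).false

namespace IsCompactScale

variable {S : Set ℝ} {a b : ℝ}

theorem lastPoint_nonempty (h : IsCompactScale S a b) (x : ℝ) : {s ∈ S | s ≤ max a x}.Nonempty :=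
  ⟨a, h.left_mem, le_max_left _ _⟩

theorem lastPoint_bddAbove (x : ℝ) : BddAbove {s ∈ S | s ≤ max a x} :=
  ⟨max a x, fun _ hs => hs.2⟩

theorem lastPoint_mem (h : IsCompactScale S a b) (x : ℝ) : lastPoint S a x ∈ S :=
  h.isClosed.closure_subset_iff.2 (fun _ hu => hu.1)
    (csSup_mem_closure (h.lastPoint_nonempty x) (lastPoint_bddAbove x))

theorem lastPoint_le (h : IsCompactScale S a b) {x : ℝ} (hx : a ≤ x) : lastPoint S a x ≤ x :=
  csSup_le (h.lastPoint_nonempty x) fun s hs => by simpa [max_eq_right hx] using hs.2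

theorem le_lastPoint {s x : ℝ} (hs : s ∈ S) (hsx : s ≤ x) : s ≤ lastPoint S a x :=
  le_csSup (lastPoint_bddAbove x) ⟨hs, hsx.trans (le_max_right _ _)⟩

/-- The `max a x` in the definition keeps the set nonempty for `x < a`, so monotonicity, and with it
measurability, holds on the whole line. -/
theorem lastPoint_mono (h : IsCompactScale S a b) : Monotone (lastPoint S a) := fun x y hxy =>
  csSup_le_csSup (lastPoint_bddAbove y) (h.lastPoint_nonempty x)
    fun _ hs => ⟨hs.1, hs.2.trans (max_le_max_left a hxy)⟩

theorem lastPoint_eq (h : IsCompactScale S a b) {t x : ℝ} (ht : t ∈ S) (htx : t ≤ x)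
    (hx : x < sigma S t) : lastPoint S a x = t := by
  refine le_antisymm (not_lt.1 fun hlt => ?_) (le_lastPoint ht htx)
  exact ((sigma_le (h.lastPoint_mem x) hlt).trans
    (h.lastPoint_le ((h.subset ht).1.trans htx))).not_gt hx

/-- `f` is continuous on `S^κ` away from the right-scattered points. These are countable because
their gaps are disjoint open intervals. -/
theorem measurable_indicator_kappa (h : IsCompactScale S a b) {f : ℝ → ℝ}
    (hf : RdContinuousOn S (kappa S) f) : Measurable ((kappa S).indicator f) := by
  classical
  set C := {t ∈ S | t < sigma S t}
  have hC : C.Countable := countable_setOf_lt_sigma S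
  have hcont : ContinuousOn f (kappa S \ C) := fun t ht =>
    (hf.1 t ht.1 ((le_sigma S t).antisymm (not_lt.1 fun hlt => ht.2 ⟨ht.1.1, hlt⟩)).symm).mono
      Set.sdiff_subset
  have hmeas : Measurable ((kappa S \ C).piecewise f 0) :=
    hcont.measurable_piecewise continuous_zero.continuousOn
      (h.isClosed_kappa.measurableSet.diff hC.measurableSet)
  refine hmeas.measurable_of_countable_ne (hC.mono fun x hx => ?_)
  by_contra hxC
  refine hx ?_
  by_cases hxK : x ∈ kappa S
  · rw [Set.piecewise_eq_of_mem _ _ _ (show x ∈ kappa S \ C from ⟨hxK, hxC⟩), Set.indicator_of_mem hxK]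
  · rw [Set.piecewise_eq_of_notMem _ _ _ (fun hx' : x ∈ kappa S \ C => hxK hx'.1), Set.indicator_of_notMem hxK]
    rfl

theorem abs_stepExtension_le {f : ℝ → ℝ} {C : ℝ} (hC : 0 ≤ C)
    (hf : ∀ t ∈ kappa S, |f t| ≤ C) (x : ℝ) : ‖stepExtension S a f x‖ ≤ C := by
  unfold stepExtension
  rw [Real.norm_eq_abs]
  by_cases hx : lastPoint S a x ∈ kappa S
  · rw [Set.indicator_of_mem hx]
    exact hf _ hx
  · rwa [Set.indicator_of_notMem hx, abs_zero]

theorem intervalIntegrable_stepExtension (h : IsCompactScale S a b) {f : ℝ → ℝ}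
    (hf : RdContinuousOn S (kappa S) f) (s t : ℝ) :
    IntervalIntegrable (stepExtension S a f) MeasureTheory.volume s t := by
  obtain ⟨C, hC, hfC⟩ := h.exists_bound hf
  have hm : Measurable (stepExtension S a f) :=
    (h.measurable_indicator_kappa hf).comp h.lastPoint_mono.measurable
  exact (intervalIntegrable_const (c := C)).mono_fun' hm.aestronglyMeasurable
    (Eventually.of_forall (abs_stepExtension_le hC.le hfC))

theorem stepExtension_congr {f g : ℝ → ℝ} (hfg : ∀ t ∈ kappa S, f t = g t) :
    stepExtension S a f = stepExtension S a g := by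
  funext x
  unfold stepExtension
  rw [Set.indicator_congr hfg]

theorem primitive_congr {f g : ℝ → ℝ} (hfg : ∀ t ∈ kappa S, f t = g t) (t : ℝ) :
    primitive S a f t = primitive S a g t := by
  unfold primitive
  rw [stepExtension_congr hfg]

theorem primitive_left (f : ℝ → ℝ) : primitive S a f a = 0 := intervalIntegral.integral_same

theorem primitive_add (h : IsCompactScale S a b) {f g : ℝ → ℝ}
    (hf : RdContinuousOn S (kappa S) f) (hg : RdContinuousOn S (kappa S) g) (t : ℝ) :
    primitive S a (fun s => f s + g s) t = primitive S a f t + primitive S a g t := by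
  unfold primitive
  rw [← intervalIntegral.integral_add (h.intervalIntegrable_stepExtension hf a t)
    (h.intervalIntegrable_stepExtension hg a t)]
  congr 1
  funext x
  exact congrFun (Set.indicator_add (kappa S) f g) _

theorem primitive_const_mul (c : ℝ) (f : ℝ → ℝ) (t : ℝ) :
    primitive S a (fun s => c * f s) t = c * primitive S a f t := by
  unfold primitive
  rw [← intervalIntegral.integral_const_mul]
  congr 1
  funext x
  exact Set.indicator_const_mul (kappa S) f c _

theorem primitive_sub (h : IsCompactScale S a b) {f g : ℝ → ℝ}
    (hf : RdContinuousOn S (kappa S) f) (hg : RdContinuousOn S (kappa S) g) (t : ℝ) :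
    primitive S a (fun s => f s - g s) t = primitive S a f t - primitive S a g t := by
  have := h.primitive_add hf ((RdContinuousOn.const (-1)).mul hg) t
  rw [primitive_const_mul] at this
  rw [primitive_congr (g := fun s => f s + -1 * g s) fun s _ => by ring, this]
  ring

theorem primitive_sub_primitive (h : IsCompactScale S a b) {f : ℝ → ℝ}
    (hf : RdContinuousOn S (kappa S) f) (s t : ℝ) :
    primitive S a f t - primitive S a f s = ∫ x in s..t, stepExtension S a f x :=
  intervalIntegral.integral_interval_sub_left (h.intervalIntegrable_stepExtension hf a t)
    (h.intervalIntegrable_stepExtension hf a s)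

theorem abs_primitive_sub_le (h : IsCompactScale S a b) {f : ℝ → ℝ}
    (hf : RdContinuousOn S (kappa S) f) {C : ℝ} (hC : 0 ≤ C)
    (hfC : ∀ t ∈ kappa S, |f t| ≤ C) (s t : ℝ) :
    |primitive S a f t - primitive S a f s| ≤ C * |t - s| := by
  rw [h.primitive_sub_primitive hf]
  exact intervalIntegral.norm_integral_le_of_norm_le_const fun x _ =>
    abs_stepExtension_le hC hfC x

theorem abs_primitive_right_le (h : IsCompactScale S a b) {f : ℝ → ℝ}
    (hf : RdContinuousOn S (kappa S) f) {C : ℝ} (hC : 0 ≤ C)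
    (hfC : ∀ t ∈ kappa S, |f t| ≤ C) : |primitive S a f b| ≤ C * (b - a) := by
  have := h.abs_primitive_sub_le hf hC hfC a b
  rwa [primitive_left, sub_zero, abs_of_pos (sub_pos.2 h.lt)] at this

theorem continuous_primitive (h : IsCompactScale S a b) {f : ℝ → ℝ}
    (hf : RdContinuousOn S (kappa S) f) : Continuous (primitive S a f) := by
  obtain ⟨C, hC, hfC⟩ := h.exists_bound hf
  refine (LipschitzWith.of_dist_le_mul (K := ⟨C, hC.le⟩) fun s t => ?_).continuous
  exact h.abs_primitive_sub_le hf hC.le hfC t s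

theorem primitive_sigma_sub (h : IsCompactScale S a b) {f : ℝ → ℝ}
    (hf : RdContinuousOn S (kappa S) f) {t : ℝ} (ht : t ∈ kappa S) :
    primitive S a f (sigma S t) - primitive S a f t = f t * (sigma S t - t) := by
  rw [h.primitive_sub_primitive hf, mul_comm, ← smul_eq_mul, ← intervalIntegral.integral_const]
  refine intervalIntegral.integral_congr_ae ?_
  -- The step extension equals `f t` on `[t, σ(t))` only; the endpoint `σ(t)` is a null set.
  have hne : ∀ᵐ x : ℝ, x ≠ sigma S t := MeasureTheory.Measure.ae_ne _ _
  filter_upwards [hne] with x hx hmem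
  rw [Set.uIoc_of_le (le_sigma S t)] at hmem
  unfold stepExtension
  rw [h.lastPoint_eq ht.1 hmem.1.le (hmem.2.lt_of_ne hx), Set.indicator_of_mem ht]

theorem isAntiderivative_primitive (h : IsCompactScale S a b) {f : ℝ → ℝ}
    (hf : RdContinuousOn S (kappa S) f) : IsAntiderivative S (primitive S a f) f := by
  intro t ht
  rcases (le_sigma S t).lt_or_eq with hlt | heq
  · have := hasDeltaDerivAt_of_lt (h.continuous_primitive hf).continuousWithinAt hlt (S := S)
    rwa [h.primitive_sigma_sub hf ht, mul_div_cancel_right₀ _ (sub_pos.2 hlt).ne'] at this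
  · intro ε hε
    rw [← heq]
    have hc := Metric.continuousWithinAt_iff.1 (hf.1 t ht heq.symm) ε hε
    obtain ⟨δ, hδ, hc⟩ := hc
    filter_upwards [h.kappa_mem_nhdsWithin ht, mem_nhdsWithin_of_mem_nhds (Metric.ball_mem_nhds t hδ)]
      with s hs hst
    have hconst : f t * (t - s) = ∫ _ in s..t, f t := by
      rw [intervalIntegral.integral_const, smul_eq_mul, mul_comm]
    rw [h.primitive_sub_primitive hf, hconst, ← intervalIntegral.integral_sub
      (h.intervalIntegrable_stepExtension hf s t) intervalIntegrable_const]
    refine intervalIntegral.norm_integral_le_of_norm_le_const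
      (f := fun x => stepExtension S a f x - f t) fun x hx => ?_
    have hx' := Set.uIoc_subset_uIcc hx
    rw [Set.uIcc, Set.mem_Icc] at hx'
    have hmin : min s t ∈ kappa S := by rcases min_choice s t with he | he <;> rw [he] <;> assumption
    have hmax : max s t ∈ kappa S := by rcases max_choice s t with he | he <;> rw [he] <;> assumption
    -- For `x` between `s` and `t` its last point also lies between them and in `S^κ`, so continuity
    -- of `f` at `t` controls the integrand.
    have h1 : min s t ≤ lastPoint S a x := le_lastPoint hmin.1 hx'.1
    have h2 : lastPoint S a x ≤ max s t :=
      (h.lastPoint_le ((h.subset hmin.1).1.trans hx'.1)).trans hx'.2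
    have h3 : lastPoint S a x ∈ kappa S := h.mem_kappa_of_le (h.lastPoint_mem x) hmax h2
    unfold stepExtension
    rw [Set.indicator_of_mem h3]
    refine (hc h3 ?_).le
    refine lt_of_le_of_lt ?_ hst
    exact Set.abs_sub_left_of_mem_uIcc (a := t) (b := s) (by rw [Set.uIcc_comm]; exact ⟨h1, h2⟩)

theorem primitive_eq_sub (h : IsCompactScale S a b) {F f : ℝ → ℝ}
    (hf : RdContinuousOn S (kappa S) f) (hF : IsAntiderivative S F f) {t : ℝ} (ht : t ∈ S) :
    primitive S a f t = F t - F a := by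
  have := h.eq_of_hasDeltaDerivAt_zero (f := fun s => primitive S a f s - F s)
    (fun s hs => by simpa using (h.isAntiderivative_primitive hf s hs).sub (hF s hs)) ht
  rw [primitive_left] at this
  linarith

theorem deltaIntegral_eq_primitive (h : IsCompactScale S a b) {f : ℝ → ℝ}
    (hf : RdContinuousOn S (kappa S) f) : deltaIntegral S f a b = primitive S a f b := by
  have hex : ∃ F, IsAntiderivative S F f := ⟨_, h.isAntiderivative_primitive hf⟩
  unfold deltaIntegral
  rw [dif_pos hex, h.primitive_eq_sub hf hex.choose_spec h.right_mem]

theorem isC1rd_of_isAntiderivative (h : IsCompactScale S a b) {F f : ℝ → ℝ}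
    (hf : RdContinuousOn S (kappa S) f) (hF : IsAntiderivative S F f) : IsC1rd S F :=
  ⟨fun t ht => ⟨f t, hF t ht⟩, hf.congr fun t ht => h.deltaDeriv_eq ht (hF t ht)⟩

/-- The primitive of `f²` is monotone and zero at both ends, hence zero on `S`; uniqueness of its
Δ-derivative gives `f² = 0` at every point of `S^κ`, scattered or dense. -/
theorem eq_zero_of_primitive_sq_eq_zero (h : IsCompactScale S a b) {f : ℝ → ℝ}
    (hf : RdContinuousOn S (kappa S) f) (h0 : primitive S a (fun s => f s * f s) b = 0) {t : ℝ}
    (ht : t ∈ kappa S) : f t = 0 := by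
  have hff := hf.mul hf
  have hnonneg : ∀ x, 0 ≤ stepExtension S a (fun s => f s * f s) x := fun x =>
    Set.indicator_nonneg (fun s _ => mul_self_nonneg (f s)) _
  have hmono : ∀ s u, s ≤ u → primitive S a (fun s => f s * f s) s
      ≤ primitive S a (fun s => f s * f s) u := fun s u hsu => by
    rw [← sub_nonneg, h.primitive_sub_primitive hff]
    exact intervalIntegral.integral_nonneg hsu fun x _ => hnonneg x
  have hzero : ∀ s ∈ S, primitive S a (fun s => f s * f s) s = 0 := fun s hs => by
    have h1 := hmono a s (h.subset hs).1
    have h2 := hmono s b (h.subset hs).2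
    rw [primitive_left] at h1
    linarith
  have hd : HasDeltaDerivAt S (primitive S a (fun s => f s * f s)) 0 t := by
    intro ε hε
    filter_upwards [self_mem_nhdsWithin] with s hs
    rw [hzero _ (sigma_mem h.isClosed ht.1), hzero s hs]
    simpa using by positivity
  exact mul_self_eq_zero.1
    (h.hasDeltaDerivAt_unique ht (h.isAntiderivative_primitive hff t ht) hd)

end IsCompactScale

/-! ### First variation and the Euler–Lagrange equation in integral form. -/

theorem hasDerivAt_lagrangian_segment {L : ℝ → ℝ → ℝ → ℝ} {t : ℝ}
    (hL : Differentiable ℝ (fun p : ℝ × ℝ => L t p.1 p.2)) (y v u w θ : ℝ) :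
    HasDerivAt (fun θ => L t (y + θ * u) (v + θ * w))
      (partialY L t (y + θ * u) (v + θ * w) * u + partialV L t (y + θ * u) (v + θ * w) * w) θ := by
  set q : ℝ × ℝ := (y + θ * u, v + θ * w)
  have hF := (hL q).hasFDerivAt
  set A := fderiv ℝ (fun p : ℝ × ℝ => L t p.1 p.2) q
  have hY : partialY L t (y + θ * u) (v + θ * w) = A (1, 0) := by
    have hl : HasDerivAt (fun z : ℝ => (z, v + θ * w)) ((1, 0) : ℝ × ℝ) (y + θ * u) :=
      (hasDerivAt_id _).prodMk (hasDerivAt_const _ _)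
    exact (HasFDerivAt.comp_hasDerivAt (y + θ * u) hF hl).deriv
  have hV : partialV L t (y + θ * u) (v + θ * w) = A (0, 1) := by
    have hl : HasDerivAt (fun z : ℝ => (y + θ * u, z)) ((0, 1) : ℝ × ℝ) (v + θ * w) :=
      (hasDerivAt_const _ _).prodMk (hasDerivAt_id _)
    exact (HasFDerivAt.comp_hasDerivAt (v + θ * w) hF hl).deriv
  have hline : HasDerivAt (fun θ : ℝ => (y + θ * u, v + θ * w)) (u, w) θ :=
    ((hasDerivAt_mul_const u).const_add y).prodMk ((hasDerivAt_mul_const w).const_add v)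
  have hA : A (u, w) = A (1, 0) * u + A (0, 1) * w := by
    have : ((u, w) : ℝ × ℝ) = u • (1, 0) + w • (0, 1) := by simp
    rw [this, map_add, map_smul, map_smul, smul_eq_mul, smul_eq_mul]
    ring
  rw [hY, hV, ← hA]
  exact hF.comp_hasDerivAt θ hline

/-- The mean value theorem on the segment from `(y, v)` to `(y + u, v + w)` replaces the increment
by the partial derivatives at an intermediate point, which differ from those at `(y, v)` by at most
`κ`. -/
theorem abs_lagrangian_sub_le {L : ℝ → ℝ → ℝ → ℝ} {t : ℝ}
    (hL : Differentiable ℝ (fun p : ℝ × ℝ => L t p.1 p.2)) {y v u w κ : ℝ}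
    (hY : ∀ y' v', |y' - y| ≤ |u| → |v' - v| ≤ |w| → |partialY L t y' v' - partialY L t y v| ≤ κ)
    (hV : ∀ y' v', |y' - y| ≤ |u| → |v' - v| ≤ |w| →
      |partialV L t y' v' - partialV L t y v| ≤ κ) :
    |L t (y + u) (v + w) - L t y v - (partialY L t y v * u + partialV L t y v * w)|
      ≤ κ * (|u| + |w|) := by
  have hd := hasDerivAt_lagrangian_segment hL y v u w
  obtain ⟨θ, hθ, hslope⟩ := exists_hasDerivAt_eq_slope _ _ zero_lt_one
    (fun θ _ => (hd θ).continuousAt.continuousWithinAt) fun θ _ => hd θ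
  simp only [one_mul, zero_mul, add_zero, sub_zero, div_one] at hslope
  have hle : ∀ z : ℝ, |θ * z| ≤ |z| := fun z => by
    rw [abs_mul, abs_of_pos hθ.1]
    exact mul_le_of_le_one_left (abs_nonneg z) hθ.2.le
  have h1 := hY (y + θ * u) (v + θ * w) (by simpa using hle u) (by simpa using hle w)
  have h2 := hV (y + θ * u) (v + θ * w) (by simpa using hle u) (by simpa using hle w)
  rw [← hslope]
  calc _ = |(partialY L t (y + θ * u) (v + θ * w) - partialY L t y v) * u
        + (partialV L t (y + θ * u) (v + θ * w) - partialV L t y v) * w| := by congr 1; ring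
    _ ≤ _ := abs_add_le _ _
    _ ≤ _ := by
      rw [abs_mul, abs_mul, mul_add]
      gcongr

namespace IsCompactScale

variable {S : Set ℝ} {a b : ℝ}

theorem continuousOn_kappa_of_isC1rd {y : ℝ → ℝ} (hy : IsC1rd S y) :
    ContinuousOn y (kappa S) := fun t ht =>
  ((hy.1 t ht).hasDeltaDerivAt.continuousWithinAt ht.1).mono (kappa_subset S)

theorem deltaDeriv_add_const_mul (h : IsCompactScale S a b) {y η : ℝ → ℝ} (hy : IsC1rd S y)
    (hη : IsC1rd S η) (e : ℝ) {t : ℝ} (ht : t ∈ kappa S) :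
    deltaDeriv S (fun s => y s + e * η s) t = deltaDeriv S y t + e * deltaDeriv S η t :=
  h.deltaDeriv_eq ht ((hy.1 t ht).hasDeltaDerivAt.add ((hη.1 t ht).hasDeltaDerivAt.const_mul e))

theorem isC1rd_add_const_mul (h : IsCompactScale S a b) {y η : ℝ → ℝ} (hy : IsC1rd S y)
    (hη : IsC1rd S η) (e : ℝ) : IsC1rd S (fun s => y s + e * η s) :=
  h.isC1rd_of_isAntiderivative (hy.2.add ((RdContinuousOn.const e).mul hη.2)) fun t ht =>
    (hy.1 t ht).hasDeltaDerivAt.add ((hη.1 t ht).hasDeltaDerivAt.const_mul e)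

theorem c1Norm_const_mul_le (h : IsCompactScale S a b) {η : ℝ → ℝ} (hη : IsC1rd S η) {C : ℝ}
    (h1 : ∀ t ∈ kappa S, |η t| ≤ C) (h2 : ∀ t ∈ kappa S, |deltaDeriv S η t| ≤ C) (e : ℝ) :
    c1Norm S (fun t => e * η t) ≤ 2 * (|e| * C) := by
  have hne : (kappa S).Nonempty := ⟨a, h.left_mem_kappa⟩
  rw [two_mul]
  refine add_le_add (csSup_le (hne.image _) ?_) (csSup_le (hne.image _) ?_)
  · rintro _ ⟨t, ht, rfl⟩
    show |e * η t| ≤ _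
    rw [abs_mul]
    exact mul_le_mul_of_nonneg_left (h1 t ht) (abs_nonneg e)
  · rintro _ ⟨t, ht, rfl⟩
    show |deltaDeriv S (fun t => e * η t) t| ≤ _
    rw [h.deltaDeriv_eq ht ((hη.1 t ht).hasDeltaDerivAt.const_mul e), abs_mul]
    exact mul_le_mul_of_nonneg_left (h2 t ht) (abs_nonneg e)

/-- The first variation of the functional vanishes at a local minimizer. -/
theorem firstVariation_eq_zero (h : IsCompactScale S a b) {L : ℝ → ℝ → ℝ → ℝ} {ya yb : ℝ}
    {y : ℝ → ℝ} (hL : IsLagrangian S a b ya yb L) (hy : IsLocalMinimizer S a b ya yb L y)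
    {η : ℝ → ℝ} (hη : IsC1rd S η) (hηa : η a = 0) (hηb : η b = 0) :
    primitive S a (fun t => along S (partialY L) y t * η t
      + along S (partialV L) y t * deltaDeriv S η t) b = 0 := by
  obtain ⟨hadm, δ, hδ, hmin⟩ := hy
  obtain ⟨C₁, hC₁, h1⟩ := h.exists_bound (continuousOn_kappa_of_isC1rd hη).rdContinuousOn
  obtain ⟨C₂, hC₂, h2⟩ := h.exists_bound hη.2
  set C := max C₁ C₂
  have hC : 0 < C := lt_max_of_lt_left hC₁
  replace h1 : ∀ t ∈ kappa S, |η t| ≤ C := fun t ht => (h1 t ht).trans (le_max_left _ _)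
  replace h2 : ∀ t ∈ kappa S, |deltaDeriv S η t| ≤ C := fun t ht =>
    (h2 t ht).trans (le_max_right _ _)
  set V : ℝ → ℝ := fun t => along S (partialY L) y t * η t
      + along S (partialV L) y t * deltaDeriv S η t
  obtain ⟨hrL, hrY, hrV⟩ := hL.rdContinuous y hadm
  have hV : RdContinuousOn S (kappa S) V :=
    (hrY.mul (continuousOn_kappa_of_isC1rd hη).rdContinuousOn).add (hrV.mul hη.2)
  set D := primitive S a V b
  have hadm' : ∀ e, Admissible S a b ya yb (fun s => y s + e * η s) := fun e =>
    ⟨h.isC1rd_add_const_mul hadm.1 hη e, by simp [hηa, hadm.2.1], by simp [hηb, hadm.2.2]⟩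
  have hba : 0 < b - a := sub_pos.2 h.lt
  -- For small `e`, the functional at `y + e η` differs from its value at `y` by `e D` up to `|e| κ
  -- · 2C(b - a)`, by uniform continuity of `L_y` and `L_v` along `y`. Minimality then bounds `-(e
  -- D)`; the two signs of `e` bound `|D|`.
  have key : ∀ κ > 0, |D| ≤ κ * (2 * C * (b - a)) := by
    intro κ hκ
    obtain ⟨-, huY, huV⟩ := hL.uniform y hadm
    obtain ⟨δ₁, hδ₁, huY⟩ := huY κ hκ
    obtain ⟨δ₂, hδ₂, huV⟩ := huV κ hκ
    have hsmall : ∀ e : ℝ, |e| * C < min δ₁ δ₂ → 2 * (|e| * C) < δ →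
        -(e * D) ≤ |e| * (κ * (2 * C * (b - a))) := by
      intro e he heδ
      have hle := hmin _ (hadm' e) (by
        have : (fun t => y t + e * η t - y t) = fun t => e * η t := by
          funext t
          ring
        rw [this]
        exact (h.c1Norm_const_mul_le hη h1 h2 e).trans_lt heδ)
      have hre := (hL.rdContinuous _ (hadm' e)).1
      unfold functional at hle
      rw [h.deltaIntegral_eq_primitive hrL, h.deltaIntegral_eq_primitive hre] at hle
      have heV := (RdContinuousOn.const e).mul hV
      have hbound := h.abs_primitive_right_le ((hre.sub hrL).sub heV)
        (C := |e| * (κ * (2 * C))) (by positivity) (by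
          intro t ht
          have hu : |e * η t| ≤ |e| * C := by
            rw [abs_mul]
            exact mul_le_mul_of_nonneg_left (h1 t ht) (abs_nonneg e)
          have hw : |e * deltaDeriv S η t| ≤ |e| * C := by
            rw [abs_mul]
            exact mul_le_mul_of_nonneg_left (h2 t ht) (abs_nonneg e)
          have hexp := abs_lagrangian_sub_le (hL.differentiable t ht) (y := y t)
            (v := deltaDeriv S y t) (u := e * η t) (w := e * deltaDeriv S η t) (κ := κ)
            (fun y' v' hy' hv' => (huY t ht y' v'
              ((hy'.trans hu).trans_lt (he.trans_le (min_le_left _ _)))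
              ((hv'.trans hw).trans_lt (he.trans_le (min_le_left _ _)))).le)
            (fun y' v' hy' hv' => (huV t ht y' v'
              ((hy'.trans hu).trans_lt (he.trans_le (min_le_right _ _)))
              ((hv'.trans hw).trans_lt (he.trans_le (min_le_right _ _)))).le)
          have heq : along S L (fun s => y s + e * η s) t - along S L y t - e * V t
              = L t (y t + e * η t) (deltaDeriv S y t + e * deltaDeriv S η t)
                - L t (y t) (deltaDeriv S y t)
                - (partialY L t (y t) (deltaDeriv S y t) * (e * η t)
                  + partialV L t (y t) (deltaDeriv S y t) * (e * deltaDeriv S η t)) := by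
            simp only [along, V, h.deltaDeriv_add_const_mul hadm.1 hη e ht]
            ring
          rw [heq]
          refine hexp.trans ?_
          nlinarith)
      rw [h.primitive_sub (hre.sub hrL) heV, h.primitive_sub hre hrL, primitive_const_mul] at hbound
      have := le_of_abs_le hbound
      linarith
    obtain ⟨e, he0, he1, he2⟩ : ∃ e > 0, e * C < min δ₁ δ₂ ∧ 2 * (e * C) < δ := by
      -- Here `e C` is half of `min (min δ₁ δ₂) (δ / 2)`, which meets both smallness conditions
      -- strictly.
      refine ⟨min (min δ₁ δ₂) (δ / 2) / 2 / C, by positivity, ?_, ?_⟩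
      · rw [div_mul_cancel₀ _ hC.ne']
        have h3 : 0 < min (min δ₁ δ₂) (δ / 2) := by positivity
        have h4 := min_le_left (min δ₁ δ₂) (δ / 2)
        linarith
      · rw [div_mul_cancel₀ _ hC.ne']
        have h4 := min_le_right (min δ₁ δ₂) (δ / 2)
        linarith
    have hp := hsmall e (by rwa [abs_of_pos he0]) (by rwa [abs_of_pos he0])
    have hm := hsmall (-e) (by rwa [abs_neg, abs_of_pos he0]) (by rwa [abs_neg, abs_of_pos he0])
    rw [abs_neg] at hm
    rw [abs_of_pos he0] at hp hm
    refine abs_le.2 ⟨?_, ?_⟩ <;> refine le_of_mul_le_mul_left ?_ he0 <;> linarith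
  by_contra hD
  have hpos : 0 < |D| := abs_pos.2 hD
  have := key (|D| / 2 / (2 * C * (b - a))) (by positivity)
  rw [div_mul_cancel₀ _ (by positivity)] at this
  linarith

/-- The Euler–Lagrange equation in integral form. -/
theorem exists_along_partialV_eq (h : IsCompactScale S a b) {L : ℝ → ℝ → ℝ → ℝ} {ya yb : ℝ}
    {y : ℝ → ℝ} (hL : IsLagrangian S a b ya yb L) (hy : IsLocalMinimizer S a b ya yb L y) :
    ∃ c, ∀ t ∈ kappa S, along S (partialV L) y t
      = c + primitive S a (along S (partialY L) y) (sigma S t) := by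
  obtain ⟨-, hrY, hrV⟩ := hL.rdContinuous y hy.1
  set f := along S (partialY L) y
  set g := along S (partialV L) y
  set A := primitive S a f
  have hA : IsAntiderivative S A f := h.isAntiderivative_primitive hrY
  have hAσ : RdContinuousOn S (kappa S) (fun t => A (sigma S t)) :=
    h.rdContinuousOn_comp_sigma (h.continuous_primitive hrY).continuousOn
  have hgA := hrV.sub hAσ
  -- The mean value of `g - A ∘ σ`: the choice for which the primitive `η` of `k` vanishes at `b`
  -- and is an allowed variation.
  set c := primitive S a (fun t => g t - A (sigma S t)) b / (b - a)
  have hba : b - a ≠ 0 := (sub_pos.2 h.lt).ne'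
  refine ⟨c, fun t ht => ?_⟩
  have hk := hgA.sub (RdContinuousOn.const c)
  set k : ℝ → ℝ := fun t => g t - A (sigma S t) - c
  set η := primitive S a k
  have hη : IsAntiderivative S η k := h.isAntiderivative_primitive hk
  have hη1 : IsC1rd S η := h.isC1rd_of_isAntiderivative hk hη
  have hid : IsAntiderivative S (fun s => c * s) (fun _ => c) := fun s _ ε hε => by
    filter_upwards with u
    rw [show c * sigma S s - c * u - c * (sigma S s - u) = 0 by ring, abs_zero]
    positivity
  have hηa : η a = 0 := primitive_left k
  have hηb : η b = 0 := by
    have h1 := h.primitive_sub hgA (RdContinuousOn.const c) b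
    have h2 := h.primitive_eq_sub (RdContinuousOn.const c) hid h.right_mem
    have h3 : c * (b - a) = primitive S a (fun t => g t - A (sigma S t)) b :=
      div_mul_cancel₀ _ hba
    show primitive S a k b = 0
    rw [h1, h2]
    linarith
  have hfirst := h.firstVariation_eq_zero hL hy hη1 hηa hηb
  have hηr : RdContinuousOn S (kappa S) η := (continuousOn_kappa_of_isC1rd hη1).rdContinuousOn
  -- Integration by parts: `A η` has Δ-derivative `f η + (A ∘ σ) k`, whose integral is a boundary
  -- term that vanishes with `η`.
  have hparts := h.primitive_eq_sub ((hrY.mul hηr).add (hAσ.mul hk))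
    (fun s hs => (hA s hs).mul (hη s hs) hs.1) h.right_mem
  have hηd : ∀ s ∈ kappa S, deltaDeriv S η s = k s := fun s hs => h.deltaDeriv_eq hs (hη s hs)
  have hsq : primitive S a (fun s => k s * k s) b = 0 := by
    have h1 : ∀ s ∈ kappa S, k s * k s = (f s * η s + g s * k s)
        - (f s * η s + A (sigma S s) * k s) - c * k s := fun s _ => by
      simp only [k]
      ring
    rw [primitive_congr h1, h.primitive_sub (((hrY.mul hηr).add (hrV.mul hk)).sub
      ((hrY.mul hηr).add (hAσ.mul hk))) ((RdContinuousOn.const c).mul hk),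
      h.primitive_sub ((hrY.mul hηr).add (hrV.mul hk)) ((hrY.mul hηr).add (hAσ.mul hk)),
      primitive_const_mul, hparts, hηa, hηb,
      ← primitive_congr (f := fun s => f s * η s + g s * deltaDeriv S η s)
        (fun s hs => by rw [hηd s hs]), hfirst]
    have : primitive S a k b = 0 := hηb
    rw [this]
    ring
  have := h.eq_zero_of_primitive_sq_eq_zero hk hsq ht
  simp only [k] at this
  linarith

end IsCompactScale

/-! ### Jumps and graininess under passage from the time scale to the interval and to its `κ`. -/

theorem sigma_le_sigma_of_subset {S R : Set ℝ} (hSR : S ⊆ R) {t : ℝ}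
    (hne : {s ∈ S | t < s}.Nonempty) : sigma R t ≤ sigma S t := by
  have hsub : {s ∈ S | t < s} ⊆ {s ∈ R | t < s} := fun s hs => ⟨hSR hs.1, hs.2⟩
  unfold sigma
  rw [if_pos hne, if_pos (hne.mono hsub)]
  exact csInf_le_csInf ⟨t, fun s hs => hs.2.le⟩ hne hsub

theorem isCompactScale_interval {R : Set ℝ} (hR : IsClosed R) {a b : ℝ} (ha : a ∈ R) (hb : b ∈ R)
    (hab : a < b) : IsCompactScale (interval R a b) a b :=
  ⟨isClosed_Icc.inter hR, Set.inter_subset_left, ⟨Set.left_mem_Icc.2 hab.le, ha⟩,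
    ⟨Set.right_mem_Icc.2 hab.le, hb⟩, hab⟩

theorem sigma_interval {R : Set ℝ} (hR : IsClosed R) {a b t : ℝ} (hb : b ∈ R)
    (ht : t ∈ interval R a b) (htb : t < b) : sigma (interval R a b) t = sigma R t := by
  have hbS : b ∈ interval R a b := ⟨⟨ht.1.1.trans ht.1.2, le_rfl⟩, hb⟩
  refine le_antisymm ?_ (sigma_le_sigma_of_subset Set.inter_subset_right ⟨b, hbS, htb⟩)
  rcases (le_sigma R t).lt_or_eq with hlt | heq
  · exact sigma_le ⟨⟨ht.1.1.trans hlt.le, sigma_le hb htb⟩, sigma_mem hR ht.2⟩ hlt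
  · rw [← heq]
    refine (sigma_eq_of_forall_exists fun ε hε => ?_).le
    obtain ⟨u, hu, h1, h2⟩ := exists_mem_Ioo_of_sigma_eq hb htb heq.symm
      (lt_min hε (sub_pos.2 htb))
    have h3 := min_le_left ε (b - t)
    have h4 := min_le_right ε (b - t)
    exact ⟨u, ⟨⟨ht.1.1.trans h1.le, by linarith⟩, hu⟩, h1, by linarith⟩

/-- A right-scattered point at which the graininess is Δ-differentiable is isolated. -/
theorem eventually_eq_of_deltaDifferentiableAt_graininess {R : Set ℝ} {t : ℝ} (ht : t ∈ R)
    (hμ : DeltaDifferentiableAt R (graininess R) t) (hlt : t < sigma R t) :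
    ∀ᶠ s in 𝓝[R] t, s = t := by
  have hpos : 0 < graininess R t := sub_pos.2 hlt
  -- Only continuity of `μ` is needed: a point `s < t` within `μ(t)/2` of `t` has `σ(s) ≤ t`, so
  -- `μ(s) < μ(t)/2`, which is impossible near `t`. On the right there is nothing before `σ(t)`.
  have hc := (hμ.hasDeltaDerivAt.continuousWithinAt ht).tendsto.eventually_const_lt
    (half_lt_self hpos)
  filter_upwards [hc, self_mem_nhdsWithin, mem_nhdsWithin_of_mem_nhds (Iio_mem_nhds hlt),
    mem_nhdsWithin_of_mem_nhds (Ioi_mem_nhds (sub_lt_self t (half_pos hpos)))] with s h1 hs h2 h3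
  rcases lt_trichotomy s t with hst | hst | hst
  · have h4 := sigma_le ht hst
    have h5 : graininess R t / 2 < sigma R s - s := h1
    have h6 : t - graininess R t / 2 < s := h3
    linarith
  · exact hst
  · exact absurd (sigma_le hs hst) (not_le.2 h2)

theorem continuousWithinAt_of_eventually_eq {S : Set ℝ} (f : ℝ → ℝ) {t : ℝ}
    (h : ∀ᶠ s in 𝓝[S] t, s = t) : ContinuousWithinAt f S t :=
  tendsto_const_nhds.congr' (h.mono fun s hs => by rw [hs])

namespace IsCompactScale

variable {S : Set ℝ} {a b : ℝ}

theorem sigma_kappa_of_sigma_eq (h : IsCompactScale S a b) {t : ℝ}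
    (hσ : sigma S t = t) : sigma (kappa S) t = t := by
  by_cases hex : ∃ u ∈ kappa S, t < u
  · obtain ⟨u, hu, htu⟩ := hex
    refine sigma_eq_of_forall_exists fun ε hε => ?_
    obtain ⟨v, hv, h1, h2⟩ := exists_mem_Ioo_of_sigma_eq hu.1 htu hσ
      (lt_min hε (sub_pos.2 htu))
    have h3 := min_le_left ε (u - t)
    have h4 := min_le_right ε (u - t)
    exact ⟨v, h.mem_kappa_of_le hv hu (by linarith), h1, by linarith⟩
  · push Not at hex
    exact sigma_of_forall_le hex

theorem sigma_kappa_of_sigma_mem {t : ℝ} (hσ : sigma S t ∈ kappa S)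
    (hlt : t < sigma S t) : sigma (kappa S) t = sigma S t :=
  (sigma_le hσ hlt).antisymm (sigma_le_sigma_of_subset (kappa_subset S) ⟨_, hσ, hlt⟩)

/-- `S^κ` is an initial segment of `S`, so a point of it beyond `t` would be at or after `σ(t)` and
pull `σ(t)` into `S^κ`. -/
theorem sigma_kappa_of_sigma_notMem (h : IsCompactScale S a b) {t : ℝ} (ht : t ∈ S)
    (hσ : sigma S t ∉ kappa S) : sigma (kappa S) t = t :=
  sigma_of_forall_le fun _ hs => not_lt.1 fun hlt =>
    hσ (h.mem_kappa_of_le (sigma_mem h.isClosed ht) hs (sigma_le hs.1 hlt))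

/-- A primitive of `f`, composed with the forward jump operator, at a right-dense point. -/
theorem hasDeltaDerivAt_primitive_comp_sigma (h : IsCompactScale S a b) {f : ℝ → ℝ}
    (hf : RdContinuousOn S (kappa S) f) {t m : ℝ} (ht : t ∈ kappa S) (hσ : sigma S t = t)
    (hμ : HasDeltaDerivAt S (graininess S) m t) :
    HasDeltaDerivAt (kappa S) (fun s => primitive S a f (sigma S s)) ((1 + m) * f t) t := by
  have hA := h.isAntiderivative_primitive hf t ht
  rw [hasDeltaDerivAt_iff_isLittleO, hσ] at hA hμ
  rw [hasDeltaDerivAt_iff_isLittleO, h.sigma_kappa_of_sigma_eq hσ, hσ]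
  rw [← h.nhdsWithin_kappa ht] at hμ
  -- Since `σ(s) = s + μ(s)` and `μ(t) = 0`, the derivative of `μ` is a first-order expansion of `σ`
  -- at `t`. It also gives `t - σ(s) = O(t - s)`, which turns the remainder of `A` at `σ(s)` into
  -- `o(t - s)`.
  have hμ' : (fun s => (t - sigma S s) - (1 + m) * (t - s)) =o[𝓝[kappa S] t] fun s => t - s :=
    hμ.congr_left fun s => by
      simp only [graininess, hσ]
      ring
  have hO : (fun s => t - sigma S s) =O[𝓝[kappa S] t] fun s => t - s :=
    (hμ'.isBigO.add (Asymptotics.isBigO_const_mul_self (1 + m) _ _)).congr_left fun s => by ring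
  have h1 := (hA.comp_tendsto (h.tendsto_sigma ht hσ)).trans_isBigO hO
  exact (h1.add (hμ'.const_mul_left (f t))).congr_left fun s => by
    simp only [Function.comp_apply]
    ring

end IsCompactScale

theorem HasDeltaDerivAt.congr {S : Set ℝ} {f g : ℝ → ℝ} {d t : ℝ} (hf : HasDeltaDerivAt S f d t)
    (hfg : ∀ s ∈ S, g s = f s) (hσ : sigma S t ∈ S) : HasDeltaDerivAt S g d t := by
  intro ε hε
  filter_upwards [hf ε hε, self_mem_nhdsWithin] with s hs hsS
  rwa [hfg s hsS, hfg _ hσ]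

end TimeScale

/-! ### The Euler–Lagrange equation in differentiated form. -/

open TimeScale in
theorem theorem4p1 (𝕋 : Set ℝ) (h𝕋 : IsTimeScale 𝕋) (T : ℝ) (h0 : (0 : ℝ) ∈ 𝕋) (hT : T ∈ 𝕋)
    (hpos : 0 < T) (L : ℝ → ℝ → ℝ → ℝ) (π₀ πT : ℝ)
    (hL : IsLagrangian (interval 𝕋 0 T) 0 T π₀ πT L)
    (hμ : ∀ t ∈ kappa (interval 𝕋 0 T), DeltaDifferentiableAt 𝕋 (graininess 𝕋) t)
    (p : ℝ → ℝ) (hp : IsLocalMinimizer (interval 𝕋 0 T) 0 T π₀ πT L p) :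
    ∀ t ∈ kappa (kappa (interval 𝕋 0 T)),
      HasDeltaDerivAt (kappa (interval 𝕋 0 T)) (along (interval 𝕋 0 T) (partialV L) p)
        ((1 + deltaDeriv 𝕋 (graininess 𝕋) t) * along (interval 𝕋 0 T) (partialY L) p t
          + graininess 𝕋 (sigma 𝕋 t) *
            deltaDeriv (kappa (interval 𝕋 0 T)) (along (interval 𝕋 0 T) (partialY L) p) t) t ∧
      (t < sigma 𝕋 t →
        DeltaDifferentiableAt (kappa (interval 𝕋 0 T))
          (along (interval 𝕋 0 T) (partialY L) p) t) := by
  have h := isCompactScale_interval h𝕋.2 h0 hT hpos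
  set S := interval 𝕋 0 T
  have hS𝕋 : S ⊆ 𝕋 := Set.inter_subset_right
  have hK𝕋 : kappa S ⊆ 𝕋 := (kappa_subset S).trans hS𝕋
  obtain ⟨c, hEL⟩ := h.exists_along_partialV_eq hL hp
  obtain ⟨-, hrY, -⟩ := hL.rdContinuous p hp.1
  set f := along S (partialY L) p
  set g := along S (partialV L) p
  have hiso : ∀ t ∈ kappa S, t < sigma 𝕋 t → ∀ᶠ s in 𝓝[S] t, s = t := fun t ht hlt =>
    (eventually_eq_of_deltaDifferentiableAt_graininess (hK𝕋 ht) (hμ t ht) hlt).filter_mono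
      (nhdsWithin_mono t hS𝕋)
  -- The doubtful point is `t = T`, where `𝕋` may continue beyond the interval. If `T` lies in `S^κ`
  -- it is a limit of points of `S`, whereas `σ(T) > T` in `𝕋` would make it isolated.
  have hσ : ∀ t ∈ kappa S, sigma S t = sigma 𝕋 t := fun t ht => by
    rcases (h.subset ht.1).2.lt_or_eq with hlt | rfl
    · exact sigma_interval h𝕋.2 hT ht.1 hlt
    · refine h.sigma_right.trans ((le_sigma 𝕋 t).eq_of_not_lt fun hlt => ?_)
      obtain ⟨s, hs, hs'⟩ :=
        ((h.frequently_ne_of_sigma_eq ht h.sigma_right).and_eventually (hiso t ht hlt)).exists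
      exact hs hs'.symm
  intro t htκ
  have ht : t ∈ kappa S := kappa_subset _ htκ
  rcases (le_sigma 𝕋 t).lt_or_eq with hlt | heq
  · have hev : ∀ᶠ s in 𝓝[kappa S] t, s = t :=
      (hiso t ht hlt).filter_mono (nhdsWithin_mono t (kappa_subset S))
    by_cases hr : sigma S t ∈ kappa S
    · have hσK : sigma (kappa S) t = sigma 𝕋 t :=
        (IsCompactScale.sigma_kappa_of_sigma_mem hr (by rwa [hσ t ht])).trans (hσ t ht)
      have hdiff : ∀ k : ℝ → ℝ, HasDeltaDerivAt (kappa S) k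
          ((k (sigma 𝕋 t) - k t) / (sigma 𝕋 t - t)) t := fun k => by
        rw [← hσK]
        exact hasDeltaDerivAt_of_lt (continuousWithinAt_of_eventually_eq k hev) (by rwa [hσK])
      have hfd : DeltaDifferentiableAt (kappa S) f t := ⟨_, hdiff f⟩
      refine ⟨?_, fun _ => hfd⟩
      have hf1 := hfd.hasDeltaDerivAt.sub_eq ht
      have hμ1 := (hμ t ht).hasDeltaDerivAt.sub_eq (hK𝕋 ht)
      rw [hσK] at hf1
      have hg1 := h.primitive_sigma_sub hrY hr
      rw [hσ _ hr, hσ t ht] at hg1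
      have hgr := hEL _ hr
      have hgt := hEL t ht
      rw [hσ _ hr, hσ t ht] at hgr
      rw [hσ t ht] at hgt
      have hμt : graininess 𝕋 t = sigma 𝕋 t - t := rfl
      have hμr : graininess 𝕋 (sigma 𝕋 t) = sigma 𝕋 (sigma 𝕋 t) - sigma 𝕋 t := rfl
      rw [hμt] at hμ1
      rw [← hμr] at hg1
      -- After multiplication by `μ(t)` the claim is `A(σ(σ(t))) - A(σ(t)) = μ^σ f(σ(t))` with
      -- `f(σ(t))` and `μ^σ` expanded at `t`.
      convert hdiff g using 1
      rw [eq_div_iff (sub_pos.2 hlt).ne', hgr, hgt]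
      linear_combination f t * -hμ1 - graininess 𝕋 (sigma 𝕋 t) * hf1 - hg1
    -- Here `t` is an isolated maximum of `S^κ`, so every number is a Δ-derivative; as `t` lies in
    -- `S^{κ²}`, this is the case `I = {0, T}`.
    · have hσK := h.sigma_kappa_of_sigma_notMem ht.1 hr
      exact ⟨.of_eventually_eq_self _ _ hσK hev, fun _ => ⟨0, .of_eventually_eq_self _ _ hσK hev⟩⟩
  · refine ⟨?_, fun hlt => absurd heq hlt.ne⟩
    have hσt : sigma S t = t := (hσ t ht).trans heq.symm
    have hμ0 : graininess 𝕋 (sigma 𝕋 t) = 0 := by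
      rw [← heq, graininess, ← heq, sub_self]
    rw [hμ0, zero_mul, add_zero]
    -- Near `t` the points of `S` lie in `S^κ`, where the two graininess functions agree, so the
    -- derivative on `𝕋` restricts to `S`.
    have hμS : HasDeltaDerivAt S (graininess S) (deltaDeriv 𝕋 (graininess 𝕋) t) t := by
      intro ε hε
      have := ((hμ t ht).hasDeltaDerivAt ε hε).filter_mono (nhdsWithin_mono t hS𝕋)
      filter_upwards [this, h.kappa_mem_nhdsWithin ht] with s hs hsK
      rw [← heq] at hs
      rw [hσt]
      simpa only [graininess, hσ s hsK, hσ t ht] using hs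
    have hA := h.hasDeltaDerivAt_primitive_comp_sigma hrY ht hσt hμS
    have hc : HasDeltaDerivAt (kappa S) (fun _ => c) 0 t := fun ε hε => by
      filter_upwards with s
      simpa using by positivity
    have := hc.add hA
    rw [zero_add] at this
    exact this.congr hEL (by rwa [h.sigma_kappa_of_sigma_eq hσt])
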